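/- For $n\ge 1$ let $\mathcal P_n=\{(\vartheta_1,\dots,\vartheta_n)\in\mathbb R^n : \vartheta_k>0 \text{ for all } k,\ \sum_{k=1}^n\vartheta_k=1\}$. For $a,b\in\mathcal P_n$ write $a\prec b$ ($a$ is majorized by $b$) if $\sum_{l=1}^k a_l^{\downarrow}\le\sum_{l=1}^k b_l^{\downarrow}$ for all $1\le k<n$, where $a^{\downarrow},b^{\downarrow}$ are the decreasing rearrangements of $a,b$. For $\alpha\ne 1$ let $g_\alpha$ be the Riemannian metric on $\mathcal P_n$ obtained by pulling back the Euclidean metric of $\mathbb R^n$ along the map $\vartheta\mapsto\frac{2}{1-\alpha}\bigl(\vartheta_1^{(1-\alpha)/2},\dots,\vartheta_n^{(1-\alpha)/2}\bigr)$, and let $\mathrm{Scal}$ denote the scalar curvature of $(\mathcal P_n,g_\alpha)$. The Gibilisco--Isola conjecture for $(\mathcal P_n,g_\alpha)$ says that, for all $a,b\in\mathcal P_n$ with $a\prec b$, one has $\mathrm{Scal}(a)\le\mathrm{Scal}(b)$ if $\alpha\in\left]-1,0\right[$, and $\mathrm{Scal}(a)\ge\mathrm{Scal}(b)$ if $\alpha\in\left]0,1\right[$.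 **Corollary (simplification of the Gibilisco--Isola conjecture for $\mathcal P_3$).** Let $\alpha\in\left]-1,0\right[\,\cup\,\left]0,1\right[$. Suppose that for every $(a_1,a_2,a_3)\in\mathcal P_3$ with $a_1>a_2$ the function $$\left[0,\tfrac{a_1-a_2}{2}\right]\to\mathbb R,\qquad x\mapsto\frac{(a_1-x)^{\alpha}(a_2+x)^{\alpha}}{\bigl((a_1-x)^{\alpha+1}+(a_2+x)^{\alpha+1}+a_3^{\alpha+1}\bigr)^{2}}$$ is (weakly) decreasing if $\alpha\in\left]-1,0\right[$, respectively (weakly) increasing if $\alpha\in\left]0,1\right[$. Then the Gibilisco--Isola conjecture holds for $(\mathcal P_3,g_\alpha)$: for all $a,b\in\mathcal P_3$ with $a\prec b$, $\mathrm{Scal}(a)\le\mathrm{Scal}(b)$ if $\alpha\in\left]-1,0\right[$, respectively $\mathrm{Scal}(a)\ge\mathrm{Scal}(b)$ if $\alpha\in\left]0,1\right[$. -/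

import Mathlib

noncomputable section

namespace AlphaGeometry

/-! ### Riemannian geometry in a coordinate chart -/

/-- The `i`-th partial derivative of a real function of `d` real coordinates. -/
def pd {d : ℕ} (i : Fin d) (f : (Fin d → ℝ) → ℝ) (x : Fin d → ℝ) : ℝ :=
  lineDeriv ℝ f x (Pi.single i 1)

/-- The Gram matrix `(g_{ij})` of the pull-back, by a map `Φ` from coordinate space to `ℝ^N`, of the
canonical metric `g_c(u, v) = ∑ k, u k * v k` of `ℝ^N`. -/
def pullbackMetric {d N : ℕ} (Φ : (Fin d → ℝ) → (Fin N → ℝ)) (x : Fin d → ℝ) :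
    Matrix (Fin d) (Fin d) ℝ :=
  Matrix.of fun i j => ∑ k, pd i (fun y => Φ y k) x * pd j (fun y => Φ y k) x

/-- The Christoffel symbol `Γ_{ij}^k` of the Levi-Civita connection of the metric `g`. -/
def christoffel {d : ℕ} (g : (Fin d → ℝ) → Matrix (Fin d) (Fin d) ℝ) (i j k : Fin d)
    (x : Fin d → ℝ) : ℝ :=
  (1 / 2) * ∑ m, (g x)⁻¹ k m *
    (pd i (fun y => g y j m) x + pd j (fun y => g y i m) x - pd m (fun y => g y i j) x)

/-- The component along `∂_l` of `R(∂_i, ∂_j) ∂_k`, where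
`R(X, Y) Z = ∇_X ∇_Y Z - ∇_Y ∇_X Z - ∇_[X,Y] Z`. -/
def riemann {d : ℕ} (g : (Fin d → ℝ) → Matrix (Fin d) (Fin d) ℝ) (i j k l : Fin d)
    (x : Fin d → ℝ) : ℝ :=
  pd i (christoffel g j k l) x - pd j (christoffel g i k l) x
    + ∑ m, (christoffel g j k m x * christoffel g i m l x
      - christoffel g i k m x * christoffel g j m l x)

/-- The Ricci tensor `Ric(∂_j, ∂_k)`, the trace of `X ↦ R(X, ∂_j) ∂_k`. -/
def ricci {d : ℕ} (g : (Fin d → ℝ) → Matrix (Fin d) (Fin d) ℝ) (j k : Fin d)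
    (x : Fin d → ℝ) : ℝ :=
  ∑ i, riemann g i j k i x

/-- The scalar curvature of the metric `g` (positive on round spheres). -/
def scalarCurvature {d : ℕ} (g : (Fin d → ℝ) → Matrix (Fin d) (Fin d) ℝ) (x : Fin d → ℝ) : ℝ :=
  ∑ j, ∑ k, (g x)⁻¹ j k * ricci g j k x

/-! ### The space of probability distributions and its `α`-geometry -/

/-- The space `𝒫_n` of the strictly positive probability distributions on `n` points. -/
def P (n : ℕ) : Set (Fin n → ℝ) :=
  {ϑ | (∀ k, 0 < ϑ k) ∧ ∑ k, ϑ k = 1}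

/-- The map `φ_{α,n}` that induces the `α`-geometry. -/
def phi (α : ℝ) {n : ℕ} (ϑ : Fin n → ℝ) : Fin n → ℝ := fun k =>
  if α = 1 then Real.log (ϑ k) else 2 / (1 - α) * ϑ k ^ ((1 - α) / 2)

/-- The global chart of `𝒫_{n+1}`, which forgets the last coordinate. -/
def chart {n : ℕ} (ϑ : Fin (n + 1) → ℝ) : Fin n → ℝ := fun i => ϑ i.castSucc

/-- The inverse of the chart: the last coordinate is `1` minus the sum of the others. -/
def chartInv {n : ℕ} (x : Fin n → ℝ) : Fin (n + 1) → ℝ :=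
  Fin.snoc (α := fun _ => ℝ) x (1 - ∑ i, x i)

theorem chartInv_chart {n : ℕ} {ϑ : Fin (n + 1) → ℝ} (h : ϑ ∈ P (n + 1)) :
    chartInv (chart ϑ) = ϑ := by
  have hs := h.2
  rw [Fin.sum_univ_castSucc] at hs
  funext i
  refine Fin.lastCases ?_ (fun j => ?_) i
  · simp only [chartInv, chart, Fin.snoc_last]
    linarith
  · simp [chartInv, chart]

/-- The metric `g_α` of `𝒫_{n+1}` in the chart: the pull-back of `g_c` by `φ_{α,n+1}`. -/
def alphaMetric (α : ℝ) (n : ℕ) : (Fin n → ℝ) → Matrix (Fin n) (Fin n) ℝ :=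
  pullbackMetric fun x => phi α (chartInv x)

/-- The scalar curvature of the Riemannian manifold `(𝒫_{n+1}, g_α)` at the point `ϑ`. -/
def Scal (α : ℝ) {n : ℕ} (ϑ : Fin (n + 1) → ℝ) : ℝ :=
  scalarCurvature (alphaMetric α n) (chart ϑ)

/-! ### Majorization -/

/-- The decreasing rearrangement `a^↓` of `a`. -/
def decr {n : ℕ} (a : Fin n → ℝ) : Fin n → ℝ := fun i => a (Tuple.sort a i.rev)

theorem decr_antitone {n : ℕ} (a : Fin n → ℝ) : Antitone (decr a) := fun _ _ h =>
  Tuple.monotone_sort a (Fin.rev_le_rev.2 h)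

/-- The distribution `a` is majorized by the distribution `b`, that is `a ≺ b`: for `1 ≤ k < n`, the
sum of the `k` largest entries of `a` is at most that of `b`. -/
def Majorized {n : ℕ} (a b : Fin n → ℝ) : Prop :=
  ∀ k : ℕ, 1 ≤ k → k < n →
    ∑ l : Fin n with l.val < k, decr a l ≤ ∑ l : Fin n with l.val < k, decr b l

/-! ### Monotonicity of the scalar curvature -/

/-- The scalar curvature of `(𝒫_{n+1}, g_α)` is increasing with respect to majorization. -/
def ScalIncreasing (n : ℕ) (α : ℝ) : Prop :=
  ∀ a ∈ P (n + 1), ∀ b ∈ P (n + 1), Majorized a b → Scal α a ≤ Scal α b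

/-- The scalar curvature of `(𝒫_{n+1}, g_α)` is decreasing with respect to majorization. -/
def ScalDecreasing (n : ℕ) (α : ℝ) : Prop :=
  ∀ a ∈ P (n + 1), ∀ b ∈ P (n + 1), Majorized a b → Scal α b ≤ Scal α a

end AlphaGeometry

end

/-! The `α`-embedding realizes `𝒫_3` as a surface in `ℝ³` with normal vector `ϑ_k ^ ((α + 1) / 2)`.
Both its metric and its second fundamental form for this normal are, up to a constant factor, Gram
matrices of the vectors `e_i - e_n` for a weighted inner product, with weights `ϑ_k ^ (-(α + 1))`
and `ϑ_k⁻¹` respectively. Weights `s_k⁻¹` give the determinant `(∑ s_k) / ∏ s_k`, so the Gauss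
equation yields
`Scal ϑ = (α + 1) ^ 2 / 2 * (∏ ϑ_k ^ α) / (∑ ϑ_k ^ (α + 1)) ^ 2`.
If `a ≺ b` in `𝒫_3`, then up to permutations `a` arises from `b` by two Robin Hood transfers, each
of which leaves one entry fixed. Along such a transfer the scalar curvature is a nonnegative
constant times the function of the hypothesis. -/

namespace AlphaGeometry

open Filter Matrix Topology

section PartialDerivatives

variable {d : ℕ} {f g : (Fin d → ℝ) → ℝ} {x : Fin d → ℝ}

theorem pd_congr (h : f =ᶠ[𝓝 x] g) (i : Fin d) : pd i f x = pd i g x :=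
  h.lineDeriv_eq

theorem pd_eq_fderiv (hf : DifferentiableAt ℝ f x) (i : Fin d) :
    pd i f x = fderiv ℝ f x (Pi.single i 1) :=
  hf.lineDeriv_eq_fderiv

theorem pd_mul (hf : DifferentiableAt ℝ f x) (hg : DifferentiableAt ℝ g x) (i : Fin d) :
    pd i (fun y => f y * g y) x = pd i f x * g x + f x * pd i g x := by
  rw [pd_eq_fderiv (hf.fun_mul hg), pd_eq_fderiv hf, pd_eq_fderiv hg, fderiv_fun_mul hf hg]
  simp only [_root_.add_apply, _root_.smul_apply, smul_eq_mul]
  ring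

theorem pd_sum {ι : Type*} {s : Finset ι} {F : ι → (Fin d → ℝ) → ℝ}
    (hF : ∀ k ∈ s, DifferentiableAt ℝ (F k) x) (i : Fin d) :
    pd i (fun y => ∑ k ∈ s, F k y) x = ∑ k ∈ s, pd i (F k) x := by
  rw [pd_eq_fderiv (DifferentiableAt.fun_sum hF), fderiv_fun_sum hF, _root_.sum_apply]
  exact Finset.sum_congr rfl fun k hk => (pd_eq_fderiv (hF k hk) i).symm

theorem eventually_pd_eq_fderiv (hf : ContDiffAt ℝ 1 f x) (i : Fin d) :
    pd i f =ᶠ[𝓝 x] fun y => fderiv ℝ f y (Pi.single i 1) :=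
  (hf.eventually (by simp)).mono fun _ hy => pd_eq_fderiv (hy.differentiableAt one_ne_zero) i

theorem contDiffAt_pd {m n : WithTop ℕ∞} (hf : ContDiffAt ℝ n f x) (hmn : m + 1 ≤ n)
    (i : Fin d) : ContDiffAt ℝ m (pd i f) x :=
  ((hf.fderiv_right hmn).clm_apply contDiffAt_const).congr_of_eventuallyEq
    (eventually_pd_eq_fderiv (hf.of_le (le_add_self.trans hmn)) i)

theorem pd_comm (hf : ContDiffAt ℝ 2 f x) (i j : Fin d) : pd i (pd j f) x = pd j (pd i f) x := by
  have pd_pd (i j : Fin d) :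
      pd i (pd j f) x = fderiv ℝ (fderiv ℝ f) x (Pi.single i 1) (Pi.single j 1) := by
    have hf' : DifferentiableAt ℝ (fderiv ℝ f) x :=
      (hf.fderiv_right (m := 1) (by norm_num)).differentiableAt one_ne_zero
    rw [pd_congr (eventually_pd_eq_fderiv (hf.of_le one_le_two) j),
      pd_eq_fderiv (hf'.clm_apply (differentiableAt_const _)),
      fderiv_clm_apply hf' (differentiableAt_const _)]
    simp
  rw [pd_pd, pd_pd]
  exact hf.isSymmSndFDerivAt (by simp) _ _

end PartialDerivatives

section VectorPartialDerivatives

variable {d N : ℕ} {Φ Ψ : (Fin d → ℝ) → Fin N → ℝ} {x : Fin d → ℝ}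

/-- The `i`-th partial derivative of a map into `ℝ^N`, taken component by component. -/
noncomputable def pdVec (i : Fin d) (Φ : (Fin d → ℝ) → Fin N → ℝ) (x : Fin d → ℝ) : Fin N → ℝ :=
  fun k => pd i (fun y => Φ y k) x

theorem contDiffAt_pdVec {m n : WithTop ℕ∞} (hΦ : ContDiffAt ℝ n Φ x) (hmn : m + 1 ≤ n)
    (i : Fin d) : ContDiffAt ℝ m (pdVec i Φ) x :=
  contDiffAt_pi.2 fun k => contDiffAt_pd (contDiffAt_pi.1 hΦ k) hmn i

theorem pdVec_comm (hΦ : ContDiffAt ℝ 2 Φ x) (i j : Fin d) :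
    pdVec i (pdVec j Φ) x = pdVec j (pdVec i Φ) x :=
  funext fun k => pd_comm (contDiffAt_pi.1 hΦ k) i j

theorem pdVec_congr (h : Φ =ᶠ[𝓝 x] Ψ) (i : Fin d) : pdVec i Φ x = pdVec i Ψ x :=
  funext fun k => pd_congr (h.mono fun _ hy => congrFun hy k) i

theorem pd_dotProduct (hΦ : DifferentiableAt ℝ Φ x) (hΨ : DifferentiableAt ℝ Ψ x) (i : Fin d) :
    pd i (fun y => Φ y ⬝ᵥ Ψ y) x = pdVec i Φ x ⬝ᵥ Ψ x + Φ x ⬝ᵥ pdVec i Ψ x := by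
  have hΦ' := differentiableAt_pi.1 hΦ
  have hΨ' := differentiableAt_pi.1 hΨ
  simp only [dotProduct, ← Finset.sum_add_distrib]
  rw [pd_sum fun k _ => (hΦ' k).fun_mul (hΨ' k)]
  exact Finset.sum_congr rfl fun k _ => pd_mul (hΦ' k) (hΨ' k) i

theorem differentiableAt_dotProduct (hΦ : DifferentiableAt ℝ Φ x) (hΨ : DifferentiableAt ℝ Ψ x) :
    DifferentiableAt ℝ (fun y => Φ y ⬝ᵥ Ψ y) x :=
  DifferentiableAt.fun_sum fun k _ =>
    (differentiableAt_pi.1 hΦ k).fun_mul (differentiableAt_pi.1 hΨ k)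

end VectorPartialDerivatives

section MatrixCalculus

variable {E n : Type*} [NormedAddCommGroup E] [NormedSpace ℝ E] [Fintype n] [DecidableEq n]
  {M : E → Matrix n n ℝ} {x : E}

theorem differentiableAt_det (hM : ∀ i j, DifferentiableAt ℝ (fun y => M y i j) x) :
    DifferentiableAt ℝ (fun y => (M y).det) x := by
  simp only [det_apply']
  exact DifferentiableAt.fun_sum fun σ _ =>
    (HasFDerivAt.finsetProd fun i _ => (hM (σ i) i).hasFDerivAt).differentiableAt.const_mul _

theorem differentiableAt_inv_apply (hM : ∀ i j, DifferentiableAt ℝ (fun y => M y i j) x)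
    (hx : (M x).det ≠ 0) (i j : n) : DifferentiableAt ℝ (fun y => (M y)⁻¹ i j) x := by
  simp only [inv_def, Matrix.smul_apply, Ring.inverse_eq_inv', smul_eq_mul, adjugate_apply]
  refine ((differentiableAt_det hM).fun_inv hx).fun_mul (differentiableAt_det fun k l => ?_)
  rcases eq_or_ne k j with rfl | hk
  · simp only [updateRow_self, differentiableAt_const]
  · simpa only [updateRow_ne hk] using hM k l

end MatrixCalculus

section GaussEquation

variable {d N : ℕ} {Φ : (Fin d → ℝ) → Fin N → ℝ} {x : Fin d → ℝ}

theorem pullbackMetric_apply (Φ : (Fin d → ℝ) → Fin N → ℝ) (x : Fin d → ℝ) (i j : Fin d) :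
    pullbackMetric Φ x i j = pdVec i Φ x ⬝ᵥ pdVec j Φ x :=
  rfl

theorem isSymm_pullbackMetric (Φ : (Fin d → ℝ) → Fin N → ℝ) (x : Fin d → ℝ) :
    (pullbackMetric Φ x).IsSymm :=
  IsSymm.ext fun i j => dotProduct_comm (pdVec j Φ x) (pdVec i Φ x)

theorem differentiableAt_pdVec (hΦ : ContDiffAt ℝ 2 Φ x) (i : Fin d) :
    DifferentiableAt ℝ (pdVec i Φ) x :=
  (contDiffAt_pdVec (m := 1) hΦ (by norm_num) i).differentiableAt one_ne_zero

theorem differentiableAt_pullbackMetric (hΦ : ContDiffAt ℝ 2 Φ x) (i j : Fin d) :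
    DifferentiableAt ℝ (fun y => pullbackMetric Φ y i j) x :=
  differentiableAt_dotProduct (differentiableAt_pdVec hΦ i) (differentiableAt_pdVec hΦ j)

theorem pd_pullbackMetric (hΦ : ContDiffAt ℝ 2 Φ x) (i j k : Fin d) :
    pd i (fun y => pullbackMetric Φ y j k) x =
      pdVec i (pdVec j Φ) x ⬝ᵥ pdVec k Φ x + pdVec j Φ x ⬝ᵥ pdVec i (pdVec k Φ) x :=
  pd_dotProduct (differentiableAt_pdVec hΦ j) (differentiableAt_pdVec hΦ k) i

theorem christoffel_pullbackMetric (hΦ : ContDiffAt ℝ 2 Φ x) (i j k : Fin d) :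
    christoffel (pullbackMetric Φ) i j k x =
      ∑ m, (pullbackMetric Φ x)⁻¹ k m * (pdVec i (pdVec j Φ) x ⬝ᵥ pdVec m Φ x) := by
  rw [christoffel, Finset.mul_sum]
  refine Finset.sum_congr rfl fun m _ => ?_
  rw [pd_pullbackMetric hΦ, pd_pullbackMetric hΦ, pd_pullbackMetric hΦ, pdVec_comm hΦ j i,
    pdVec_comm hΦ m i, pdVec_comm hΦ m j, dotProduct_comm (pdVec j Φ x),
    dotProduct_comm (pdVec i Φ x) (pdVec j _ x)]
  ring

/-- The second fundamental form `II(∂_i, ∂_j)` of the immersion `Φ`, as a vector of `ℝ^N`: the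
second derivative of `Φ` minus its tangential part, which the Levi-Civita connection provides. -/
noncomputable def secondFundamentalForm (Φ : (Fin d → ℝ) → Fin N → ℝ) (i j : Fin d)
    (x : Fin d → ℝ) : Fin N → ℝ :=
  pdVec i (pdVec j Φ) x - ∑ l, christoffel (pullbackMetric Φ) i j l x • pdVec l Φ x

theorem sum_christoffel_mul_pullbackMetric (hΦ : ContDiffAt ℝ 2 Φ x)
    (hg : (pullbackMetric Φ x).det ≠ 0) (i j n : Fin d) :
    ∑ l, christoffel (pullbackMetric Φ) i j l x * pullbackMetric Φ x l n =
      pdVec i (pdVec j Φ) x ⬝ᵥ pdVec n Φ x := by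
  have hΓ : (fun l => christoffel (pullbackMetric Φ) i j l x) =
      (pullbackMetric Φ x)⁻¹ *ᵥ fun m => pdVec i (pdVec j Φ) x ⬝ᵥ pdVec m Φ x :=
    funext fun l => christoffel_pullbackMetric hΦ i j l
  have h := congrFun (congrArg (pullbackMetric Φ x *ᵥ ·) hΓ) n
  simp only [mulVec_mulVec, mul_nonsing_inv _ hg.isUnit, one_mulVec] at h
  rw [← h]
  exact Finset.sum_congr rfl fun l _ => by rw [mul_comm, (isSymm_pullbackMetric Φ x).apply]

theorem secondFundamentalForm_dotProduct (i j : Fin d) (v : Fin N → ℝ) :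
    secondFundamentalForm Φ i j x ⬝ᵥ v = pdVec i (pdVec j Φ) x ⬝ᵥ v -
      ∑ l, christoffel (pullbackMetric Φ) i j l x * (pdVec l Φ x ⬝ᵥ v) := by
  simp only [secondFundamentalForm, sub_dotProduct, sum_dotProduct, smul_dotProduct, smul_eq_mul]

theorem secondFundamentalForm_dotProduct_pdVec (hΦ : ContDiffAt ℝ 2 Φ x)
    (hg : (pullbackMetric Φ x).det ≠ 0) (i j n : Fin d) :
    secondFundamentalForm Φ i j x ⬝ᵥ pdVec n Φ x = 0 := by
  rw [secondFundamentalForm_dotProduct, sub_eq_zero]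
  exact (sum_christoffel_mul_pullbackMetric hΦ hg i j n).symm

theorem differentiableAt_christoffel_pullbackMetric (hΦ : ContDiffAt ℝ 3 Φ x)
    (hg : (pullbackMetric Φ x).det ≠ 0) (i j k : Fin d) :
    DifferentiableAt ℝ (christoffel (pullbackMetric Φ) i j k) x := by
  have hΦ₂ : ContDiffAt ℝ 2 Φ x := hΦ.of_le (by norm_num)
  have hΓ : christoffel (pullbackMetric Φ) i j k =ᶠ[𝓝 x] fun y =>
      ∑ m, (pullbackMetric Φ y)⁻¹ k m * (pdVec i (pdVec j Φ) y ⬝ᵥ pdVec m Φ y) :=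
    (hΦ₂.eventually (by simp)).mono fun y hy => christoffel_pullbackMetric hy i j k
  refine hΓ.differentiableAt_iff.2 (DifferentiableAt.fun_sum fun m _ => .fun_mul ?_ ?_)
  · exact differentiableAt_inv_apply (differentiableAt_pullbackMetric hΦ₂) hg k m
  · exact differentiableAt_dotProduct
      (differentiableAt_pdVec (contDiffAt_pdVec hΦ (by norm_num) j) i)
      (differentiableAt_pdVec hΦ₂ m)

/-- Obtained by differentiating the identity `∑ l, Γ_{jk}^l g_{ln} = ⟪∂_j ∂_k Φ, ∂_n Φ⟫`. -/
theorem sum_pd_christoffel_mul_pullbackMetric (hΦ : ContDiffAt ℝ 3 Φ x)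
    (hg : (pullbackMetric Φ x).det ≠ 0) (i j k n : Fin d) :
    ∑ l, (pd i (christoffel (pullbackMetric Φ) j k l) x +
        ∑ m, christoffel (pullbackMetric Φ) j k m x * christoffel (pullbackMetric Φ) i m l x) *
          pullbackMetric Φ x l n =
      pdVec i (pdVec j (pdVec k Φ)) x ⬝ᵥ pdVec n Φ x +
        secondFundamentalForm Φ j k x ⬝ᵥ pdVec i (pdVec n Φ) x := by
  set Γ := christoffel (pullbackMetric Φ)
  have hΦ₂ : ContDiffAt ℝ 2 Φ x := hΦ.of_le (by norm_num)
  have hdiff := differentiableAt_pullbackMetric hΦ₂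
  have hΓ := differentiableAt_christoffel_pullbackMetric hΦ hg j k
  have hlowered : (fun y => ∑ l, Γ j k l y * pullbackMetric Φ y l n) =ᶠ[𝓝 x]
      fun y => pdVec j (pdVec k Φ) y ⬝ᵥ pdVec n Φ y := by
    filter_upwards [hΦ₂.eventually (by simp),
      (differentiableAt_det hdiff).continuousAt.eventually_ne hg] with y hy hgy
    exact sum_christoffel_mul_pullbackMetric hy hgy j k n
  have hderiv : ∑ l, (pd i (Γ j k l) x * pullbackMetric Φ x l n +
      Γ j k l x * (pdVec i (pdVec l Φ) x ⬝ᵥ pdVec n Φ x + pdVec l Φ x ⬝ᵥ pdVec i (pdVec n Φ) x)) =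
      pdVec i (pdVec j (pdVec k Φ)) x ⬝ᵥ pdVec n Φ x +
        pdVec j (pdVec k Φ) x ⬝ᵥ pdVec i (pdVec n Φ) x := by
    rw [← pd_dotProduct (differentiableAt_pdVec (contDiffAt_pdVec hΦ (by norm_num) k) j)
      (differentiableAt_pdVec hΦ₂ n), ← pd_congr hlowered,
      pd_sum fun l _ => (hΓ l).fun_mul (hdiff l n)]
    exact Finset.sum_congr rfl fun l _ => by rw [pd_mul (hΓ l) (hdiff l n), pd_pullbackMetric hΦ₂]
  have hquadratic : ∑ l, (∑ m, Γ j k m x * Γ i m l x) * pullbackMetric Φ x l n =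
      ∑ m, Γ j k m x * (pdVec i (pdVec m Φ) x ⬝ᵥ pdVec n Φ x) := by
    simp_rw [← sum_christoffel_mul_pullbackMetric hΦ₂ hg, Finset.mul_sum, Finset.sum_mul,
      mul_assoc]
    exact Finset.sum_comm
  rw [secondFundamentalForm_dotProduct]
  simp only [add_mul, mul_add, Finset.sum_add_distrib] at hderiv ⊢
  linarith

theorem secondFundamentalForm_dotProduct_secondFundamentalForm (hΦ : ContDiffAt ℝ 2 Φ x)
    (hg : (pullbackMetric Φ x).det ≠ 0) (i j k l : Fin d) :
    secondFundamentalForm Φ i j x ⬝ᵥ secondFundamentalForm Φ k l x =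
      secondFundamentalForm Φ i j x ⬝ᵥ pdVec k (pdVec l Φ) x := by
  conv_lhs => rw [dotProduct_comm, secondFundamentalForm_dotProduct]
  simp only [dotProduct_comm _ (secondFundamentalForm Φ i j x),
    secondFundamentalForm_dotProduct_pdVec hΦ hg, mul_zero, Finset.sum_const_zero, sub_zero]

theorem gauss_equation (hΦ : ContDiffAt ℝ 3 Φ x) (hg : (pullbackMetric Φ x).det ≠ 0)
    (i j k n : Fin d) :
    ∑ l, riemann (pullbackMetric Φ) i j k l x * pullbackMetric Φ x l n =
      secondFundamentalForm Φ j k x ⬝ᵥ secondFundamentalForm Φ i n x -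
        secondFundamentalForm Φ i k x ⬝ᵥ secondFundamentalForm Φ j n x := by
  have hΦ₂ : ContDiffAt ℝ 2 Φ x := hΦ.of_le (by norm_num)
  have hi := sum_pd_christoffel_mul_pullbackMetric hΦ hg i j k n
  have hj := sum_pd_christoffel_mul_pullbackMetric hΦ hg j i k n
  have hsymm := pdVec_comm (contDiffAt_pdVec (m := 2) hΦ (by norm_num) k) i j
  rw [secondFundamentalForm_dotProduct_secondFundamentalForm hΦ₂ hg,
    secondFundamentalForm_dotProduct_secondFundamentalForm hΦ₂ hg]
  rw [hsymm] at hi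
  simp only [riemann, add_mul, sub_mul, Finset.sum_add_distrib, Finset.sum_sub_distrib] at hi hj ⊢
  linarith

end GaussEquation

section Hypersurface

theorem exists_smul_eq_of_mulVec_eq_zero {K m n : Type*} [Field K] [Fintype m] [DecidableEq m]
    [Fintype n] (hcard : Fintype.card n = Fintype.card m + 1) {J : Matrix m n K}
    (hJ : (J * Jᵀ).det ≠ 0) {u ν : n → K} (hu : J *ᵥ u = 0) (hν : J *ᵥ ν = 0) (hν₀ : ν ≠ 0) :
    ∃ c : K, c • ν = u := by
  have hsurj : Function.Surjective J.mulVecLin := fun w =>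
    ⟨Jᵀ *ᵥ (J * Jᵀ)⁻¹ *ᵥ w, by simp [mul_nonsing_inv _ hJ.isUnit, ← Matrix.mul_assoc]⟩
  have hker : Module.finrank K (LinearMap.ker J.mulVecLin) = 1 := by
    have h := J.mulVecLin.finrank_range_add_finrank_ker
    rw [LinearMap.range_eq_top.2 hsurj, finrank_top, Module.finrank_fintype_fun_eq_card,
      Module.finrank_fintype_fun_eq_card] at h
    lia
  obtain ⟨c, hc⟩ := (finrank_eq_one_iff_of_nonzero' (⟨ν, hν⟩ : LinearMap.ker J.mulVecLin)
    (by simpa [Subtype.ext_iff] using hν₀)).1 hker ⟨u, hu⟩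
  exact ⟨c, congrArg Subtype.val hc⟩

theorem riemann_pullbackMetric {d N : ℕ} {Φ : (Fin d → ℝ) → Fin N → ℝ} {x : Fin d → ℝ}
    (hΦ : ContDiffAt ℝ 3 Φ x) (hg : (pullbackMetric Φ x).det ≠ 0) (i j k l : Fin d) :
    riemann (pullbackMetric Φ) i j k l x = ∑ n,
      (secondFundamentalForm Φ j k x ⬝ᵥ secondFundamentalForm Φ i n x -
        secondFundamentalForm Φ i k x ⬝ᵥ secondFundamentalForm Φ j n x) *
          (pullbackMetric Φ x)⁻¹ n l := by
  have hlowered : (fun l => riemann (pullbackMetric Φ) i j k l x) ᵥ* pullbackMetric Φ x =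
      fun n => secondFundamentalForm Φ j k x ⬝ᵥ secondFundamentalForm Φ i n x -
        secondFundamentalForm Φ i k x ⬝ᵥ secondFundamentalForm Φ j n x :=
    funext fun n => gauss_equation hΦ hg i j k n
  have hraised := congrArg (· ᵥ* (pullbackMetric Φ x)⁻¹) hlowered
  simp only [vecMul_vecMul, mul_nonsing_inv _ hg.isUnit, vecMul_one] at hraised
  exact congrFun hraised l

/-- The second fundamental form of the immersion `Φ` with respect to a normal vector `ν`, which
need not be a unit vector. -/
noncomputable def scalarSecondForm {d N : ℕ} (Φ : (Fin d → ℝ) → Fin N → ℝ) (ν : Fin N → ℝ)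
    (x : Fin d → ℝ) : Matrix (Fin d) (Fin d) ℝ :=
  of fun i j => pdVec i (pdVec j Φ) x ⬝ᵥ ν

variable {d : ℕ} {Φ : (Fin d → ℝ) → Fin (d + 1) → ℝ} {x : Fin d → ℝ} {ν : Fin (d + 1) → ℝ}

theorem secondFundamentalForm_dotProduct_eq_div (hΦ : ContDiffAt ℝ 2 Φ x)
    (hg : (pullbackMetric Φ x).det ≠ 0) (hν : ∀ i, pdVec i Φ x ⬝ᵥ ν = 0) (hν₀ : ν ≠ 0)
    (i j k l : Fin d) :
    secondFundamentalForm Φ i j x ⬝ᵥ secondFundamentalForm Φ k l x =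
      scalarSecondForm Φ ν x i j * scalarSecondForm Φ ν x k l / (ν ⬝ᵥ ν) := by
  have hnormal (i j : Fin d) :
      ∃ c : ℝ, c • ν = secondFundamentalForm Φ i j x := by
    refine exists_smul_eq_of_mulVec_eq_zero (J := of fun i => pdVec i Φ x) (by simp) hg
      (funext fun n => ?_) (funext hν) hν₀
    exact (dotProduct_comm _ _).trans (secondFundamentalForm_dotProduct_pdVec hΦ hg i j n)
  have hscalar (i j : Fin d) :
      scalarSecondForm Φ ν x i j = secondFundamentalForm Φ i j x ⬝ᵥ ν := by
    simp [secondFundamentalForm_dotProduct, hν, scalarSecondForm]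
  have hνν : ν ⬝ᵥ ν ≠ 0 := dotProduct_self_eq_zero.not.2 hν₀
  obtain ⟨c, hc⟩ := hnormal i j
  obtain ⟨e, he⟩ := hnormal k l
  rw [hscalar, hscalar, ← hc, ← he]
  simp only [smul_dotProduct, dotProduct_smul, smul_eq_mul]
  field_simp

theorem sq_trace_sub_trace_sq_eq_sum {R n : Type*} [CommRing R] [Fintype n] [DecidableEq n]
    {G h : Matrix n n R} (hG : G.IsSymm) (hh : h.IsSymm) :
    (G * h).trace ^ 2 - ((G * h) ^ 2).trace =
      ∑ j, ∑ k, ∑ i, ∑ l, G j k * ((h j k * h i l - h i k * h j l) * G l i) := by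
  have htrace : (G * h).trace = ∑ j, ∑ k, G j k * h j k := by
    simp only [trace, diag_apply, mul_apply, hh.apply _ _]
  have htrace' : (G * h).trace = ∑ i, ∑ l, h i l * G l i := by
    rw [trace_mul_comm]
    rfl
  have htrace_sq : ((G * h) ^ 2).trace =
      ∑ j, ∑ k, ∑ i, ∑ l, G j k * (h i k * (G l i * h j l)) := by
    simp only [sq, Matrix.mul_assoc, trace, diag_apply, mul_apply, Finset.mul_sum]
    congr! 5 with j _ k _ i _ l
    rw [hh.apply i k, hh.apply j l, hG.apply l i]
  have hsq_trace : (G * h).trace ^ 2 =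
      ∑ j, ∑ k, ∑ i, ∑ l, G j k * (h j k * (h i l * G l i)) := by
    rw [sq]
    nth_rw 1 [htrace]
    simp_rw [Finset.sum_mul, htrace', mul_assoc, Finset.mul_sum]
  rw [hsq_trace, htrace_sq]
  simp only [← Finset.sum_sub_distrib]
  congr! 4
  ring

theorem scalarCurvature_hypersurface (hΦ : ContDiffAt ℝ 3 Φ x)
    (hg : (pullbackMetric Φ x).det ≠ 0) (hν : ∀ i, pdVec i Φ x ⬝ᵥ ν = 0) (hν₀ : ν ≠ 0) :
    scalarCurvature (pullbackMetric Φ) x =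
      (((pullbackMetric Φ x)⁻¹ * scalarSecondForm Φ ν x).trace ^ 2 -
        (((pullbackMetric Φ x)⁻¹ * scalarSecondForm Φ ν x) ^ 2).trace) / (ν ⬝ᵥ ν) := by
  have hΦ₂ : ContDiffAt ℝ 2 Φ x := hΦ.of_le (by norm_num)
  have hh : (scalarSecondForm Φ ν x).IsSymm :=
    IsSymm.ext fun i j => congrArg (· ⬝ᵥ ν) (pdVec_comm hΦ₂ j i)
  rw [sq_trace_sub_trace_sq_eq_sum (isSymm_pullbackMetric Φ x).inv hh]
  simp only [scalarCurvature, ricci, riemann_pullbackMetric hΦ hg, Finset.mul_sum,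
    secondFundamentalForm_dotProduct_eq_div hΦ₂ hg hν hν₀, ← sub_div, Finset.sum_div]
  congr! 4
  ring

theorem sq_trace_sub_trace_sq_fin_two {R : Type*} [CommRing R] (A : Matrix (Fin 2) (Fin 2) R) :
    A.trace ^ 2 - (A ^ 2).trace = 2 * A.det := by
  simp only [sq, trace_fin_two, det_fin_two, mul_apply, Fin.sum_univ_two]
  ring

theorem scalarCurvature_surface {Φ : (Fin 2 → ℝ) → Fin 3 → ℝ} {x : Fin 2 → ℝ} {ν : Fin 3 → ℝ}
    (hΦ : ContDiffAt ℝ 3 Φ x) (hg : (pullbackMetric Φ x).det ≠ 0)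
    (hν : ∀ i, pdVec i Φ x ⬝ᵥ ν = 0) (hν₀ : ν ≠ 0) :
    scalarCurvature (pullbackMetric Φ) x =
      2 * (scalarSecondForm Φ ν x).det / ((pullbackMetric Φ x).det * (ν ⬝ᵥ ν)) := by
  rw [scalarCurvature_hypersurface hΦ hg hν hν₀, sq_trace_sub_trace_sq_fin_two, det_mul,
    det_nonsing_inv, Ring.inverse_eq_inv']
  field_simp

end Hypersurface

section Simplex

variable {n : ℕ}

/-- The image `e_i - e_n` of the `i`-th coordinate vector under the derivative of the inverse
chart `chartInv`. -/
def simplexTangent (i : Fin n) : Fin (n + 1) → ℝ :=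
  Pi.single i.castSucc 1 - Pi.single (Fin.last n) 1

theorem simplexTangent_castSucc (i j : Fin n) :
    simplexTangent i j.castSucc = if i = j then 1 else 0 := by
  simp [simplexTangent, Pi.single_apply, eq_comm]

theorem simplexTangent_last (i : Fin n) : simplexTangent i (Fin.last n) = -1 := by
  simp [simplexTangent]

theorem sum_simplexTangent (i : Fin n) : ∑ k, simplexTangent i k = 0 := by
  simp [simplexTangent]

theorem chartInv_add_smul_single (x : Fin n → ℝ) (i : Fin n) (t : ℝ) :
    chartInv (x + t • Pi.single i 1) = chartInv x + t • simplexTangent i := by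
  funext k
  refine Fin.lastCases ?_ (fun j => ?_) k
  · simp only [chartInv, Pi.add_apply, Pi.smul_apply, smul_eq_mul, Finset.sum_add_distrib,
      ← Finset.mul_sum, Finset.sum_pi_single', Finset.mem_univ, if_true, Fin.snoc_last,
      simplexTangent_last]
    ring
  · simp [chartInv, simplexTangent_castSucc, Pi.single_apply, eq_comm]

theorem contDiff_chartInv {m : WithTop ℕ∞} : ContDiff ℝ m (chartInv (n := n)) := by
  refine contDiff_pi.2 fun k => Fin.lastCases ?_ (fun j => ?_) k
  · simp only [chartInv, Fin.snoc_last]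
    fun_prop
  · simp only [chartInv, Fin.snoc_castSucc]
    fun_prop

theorem eventually_chartInv_pos {x : Fin n → ℝ} (hx : ∀ k, 0 < chartInv x k) :
    ∀ᶠ y in 𝓝 x, ∀ k, 0 < chartInv y k :=
  eventually_all.2 fun k => continuousAt_const.eventually_lt
    (contDiff_pi.1 (contDiff_chartInv (m := 0)) k).continuous.continuousAt (hx k)

theorem pd_comp_chartInv {f : ℝ → ℝ} {f' : ℝ} {x : Fin n → ℝ} {k : Fin (n + 1)}
    (hf : HasDerivAt f f' (chartInv x k)) (i : Fin n) :
    pd i (fun y => f (chartInv y k)) x = f' * simplexTangent i k := by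
  refine HasLineDerivAt.lineDeriv ?_
  have hline : HasDerivAt (fun t : ℝ => chartInv x k + t * simplexTangent i k)
      (simplexTangent i k) 0 := by
    simpa using ((hasDerivAt_id (0 : ℝ)).mul_const (simplexTangent i k)).const_add (chartInv x k)
  simp only [HasLineDerivAt, chartInv_add_smul_single, Pi.add_apply, Pi.smul_apply, smul_eq_mul]
  exact HasDerivAt.comp 0 (by simpa using hf) hline

/-- The Gram matrix of the vectors `simplexTangent i` for the inner product of `ℝ^{n+1}` with
weights `p`. -/
def simplexGram (p : Fin (n + 1) → ℝ) : Matrix (Fin n) (Fin n) ℝ :=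
  of fun i j => ∑ k, p k * simplexTangent i k * simplexTangent j k

theorem simplexGram_eq_diagonal_add (p : Fin (n + 1) → ℝ) :
    simplexGram p = diagonal (fun i : Fin n => p i.castSucc) +
      replicateCol Unit (fun _ : Fin n => p (Fin.last n)) * replicateRow Unit (1 : Fin n → ℝ) := by
  ext i j
  rcases eq_or_ne i j with rfl | hij
  · simp [simplexGram, Fin.sum_univ_castSucc, simplexTangent_castSucc, simplexTangent_last,
      mul_apply]
  · simp [simplexGram, Fin.sum_univ_castSucc, simplexTangent_castSucc, simplexTangent_last,
      mul_apply, hij]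

theorem det_simplexGram_inv {s : Fin (n + 1) → ℝ} (hs : ∀ k, s k ≠ 0) :
    (simplexGram fun k => (s k)⁻¹).det = (∑ k, s k) / ∏ k, s k := by
  have hprod : ∏ i : Fin n, s i.castSucc ≠ 0 := Finset.prod_ne_zero_iff.2 fun i _ => hs i.castSucc
  have hlast : s (Fin.last n) ≠ 0 := hs (Fin.last n)
  have hdet : (diagonal fun i : Fin n => (s i.castSucc)⁻¹).det = (∏ i : Fin n, s i.castSucc)⁻¹ := by
    rw [det_diagonal, Finset.prod_inv_distrib]
  have hinv : (diagonal fun i : Fin n => (s i.castSucc)⁻¹)⁻¹ = diagonal fun i => s i.castSucc :=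
    inv_eq_right_inv (by simp [hs])
  rw [simplexGram_eq_diagonal_add,
    det_add_replicateCol_mul_replicateRow (hdet ▸ (inv_ne_zero hprod).isUnit), hdet, hinv]
  simp only [det_unique, Matrix.add_apply, one_apply_eq, mul_apply, diagonal_apply,
    replicateRow_apply, replicateCol_apply, Pi.one_apply, one_mul, ← Finset.sum_mul,
    Fin.sum_univ_castSucc, Fin.prod_univ_castSucc, Finset.sum_ite_eq', Finset.mem_univ, if_true]
  field_simp
  ring

end Simplex

section AlphaMetric

variable {n : ℕ} {x : Fin n → ℝ}

/-- The function that `phi α` applies to each coordinate. -/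
noncomputable def alphaEmbedding (α t : ℝ) : ℝ :=
  if α = 1 then Real.log t else 2 / (1 - α) * t ^ ((1 - α) / 2)

theorem hasDerivAt_alphaEmbedding (α : ℝ) {t : ℝ} (ht : 0 < t) :
    HasDerivAt (alphaEmbedding α) (t ^ (-(α + 1) / 2)) t := by
  rcases eq_or_ne α 1 with rfl | hα
  · have hdef : alphaEmbedding 1 = Real.log := funext fun s => if_pos rfl
    rw [hdef]
    refine (Real.hasDerivAt_log ht.ne').congr_deriv ?_
    rw [← Real.rpow_neg_one]
    norm_num
  · have hα' : 1 - α ≠ 0 := sub_ne_zero.2 hα.symm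
    have hdef : alphaEmbedding α = fun s => 2 / (1 - α) * s ^ ((1 - α) / 2) :=
      funext fun s => if_neg hα
    rw [hdef]
    refine ((Real.hasDerivAt_rpow_const (Or.inl ht.ne')).const_mul _).congr_deriv ?_
    rw [show (1 - α) / 2 - 1 = -(α + 1) / 2 by ring]
    field_simp

theorem contDiffAt_alphaEmbedding (α : ℝ) {t : ℝ} (ht : 0 < t) {m : WithTop ℕ∞} :
    ContDiffAt ℝ m (alphaEmbedding α) t := by
  unfold alphaEmbedding
  split_ifs
  · exact contDiffAt_id.log ht.ne'
  · exact contDiffAt_const.mul (contDiffAt_id.rpow_const_of_ne ht.ne')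

/-- The parametrization of `𝒫_{n+1} ⊆ ℝ^{n+1}` that induces the metric `alphaMetric α n`. -/
noncomputable def alphaImmersion (α : ℝ) (x : Fin n → ℝ) : Fin (n + 1) → ℝ :=
  phi α (chartInv x)

theorem contDiffAt_alphaImmersion (α : ℝ) (hx : ∀ k, 0 < chartInv x k) {m : WithTop ℕ∞} :
    ContDiffAt ℝ m (alphaImmersion α) x :=
  contDiffAt_pi.2 fun k => (contDiffAt_alphaEmbedding α (hx k)).comp x
    (contDiffAt_pi.1 contDiff_chartInv.contDiffAt k)

theorem pdVec_alphaImmersion (α : ℝ) (hx : ∀ k, 0 < chartInv x k) (i : Fin n) :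
    pdVec i (alphaImmersion α) x =
      fun k => chartInv x k ^ (-(α + 1) / 2) * simplexTangent i k :=
  funext fun k => pd_comp_chartInv (hasDerivAt_alphaEmbedding α (hx k)) i

theorem pdVec_pdVec_alphaImmersion (α : ℝ) (hx : ∀ k, 0 < chartInv x k) (i j : Fin n) :
    pdVec i (pdVec j (alphaImmersion α)) x = fun k => -(α + 1) / 2 *
      chartInv x k ^ (-(α + 1) / 2 - 1) * simplexTangent i k * simplexTangent j k := by
  rw [pdVec_congr ((eventually_chartInv_pos hx).mono fun y hy => pdVec_alphaImmersion α hy j)]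
  funext k
  rw [mul_right_comm]
  exact pd_comp_chartInv (f := fun t => t ^ (-(α + 1) / 2) * simplexTangent j k)
    ((Real.hasDerivAt_rpow_const (Or.inl (hx k).ne')).mul_const _) i

theorem alphaMetric_eq_pullbackMetric (α : ℝ) (n : ℕ) :
    alphaMetric α n = pullbackMetric (alphaImmersion α) :=
  rfl

theorem pullbackMetric_alphaImmersion (α : ℝ) (hx : ∀ k, 0 < chartInv x k) :
    pullbackMetric (alphaImmersion α) x = simplexGram fun k => (chartInv x k ^ (α + 1))⁻¹ := by
  ext i j
  rw [pullbackMetric_apply, pdVec_alphaImmersion α hx, pdVec_alphaImmersion α hx]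
  refine Finset.sum_congr rfl fun k _ => ?_
  have hpow : (chartInv x k ^ (α + 1))⁻¹ =
      chartInv x k ^ (-(α + 1) / 2) * chartInv x k ^ (-(α + 1) / 2) := by
    rw [← Real.rpow_neg (hx k).le, ← Real.rpow_add (hx k), add_halves]
  simp only [hpow]
  ring

/-- A normal vector of the image of `alphaImmersion α` at the distribution `ϑ`. -/
noncomputable def alphaNormal (α : ℝ) (ϑ : Fin (n + 1) → ℝ) : Fin (n + 1) → ℝ :=
  fun k => ϑ k ^ ((α + 1) / 2)

theorem pdVec_alphaImmersion_dotProduct_alphaNormal (α : ℝ) (hx : ∀ k, 0 < chartInv x k)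
    (i : Fin n) : pdVec i (alphaImmersion α) x ⬝ᵥ alphaNormal α (chartInv x) = 0 := by
  rw [pdVec_alphaImmersion α hx, ← sum_simplexTangent i]
  refine Finset.sum_congr rfl fun k _ => ?_
  rw [alphaNormal, mul_right_comm, ← Real.rpow_add (hx k), neg_div, neg_add_cancel, Real.rpow_zero,
    one_mul]

theorem alphaNormal_dotProduct_self (α : ℝ) {ϑ : Fin (n + 1) → ℝ} (hϑ : ∀ k, 0 < ϑ k) :
    alphaNormal α ϑ ⬝ᵥ alphaNormal α ϑ = ∑ k, ϑ k ^ (α + 1) :=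
  Finset.sum_congr rfl fun k _ => by rw [alphaNormal, ← Real.rpow_add (hϑ k), add_halves]

theorem scalarSecondForm_alphaImmersion (α : ℝ) (hx : ∀ k, 0 < chartInv x k) :
    scalarSecondForm (alphaImmersion α) (alphaNormal α (chartInv x)) x =
      (-(α + 1) / 2) • simplexGram fun k => (chartInv x k)⁻¹ := by
  ext i j
  simp only [scalarSecondForm, pdVec_pdVec_alphaImmersion α hx, simplexGram, dotProduct,
    alphaNormal, of_apply, Matrix.smul_apply, smul_eq_mul, Finset.mul_sum]
  refine Finset.sum_congr rfl fun k _ => ?_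
  have hpow : chartInv x k ^ (-(α + 1) / 2 - 1) * chartInv x k ^ ((α + 1) / 2) =
      (chartInv x k)⁻¹ := by
    rw [← Real.rpow_add (hx k), ← Real.rpow_neg_one]
    ring_nf
  rw [← hpow]
  ring

theorem det_pullbackMetric_alphaImmersion (α : ℝ) (hx : ∀ k, 0 < chartInv x k) :
    (pullbackMetric (alphaImmersion α) x).det =
      (∑ k, chartInv x k ^ (α + 1)) / ((∏ k, chartInv x k ^ α) * ∏ k, chartInv x k) := by
  rw [pullbackMetric_alphaImmersion α hx,
    det_simplexGram_inv fun k => (Real.rpow_pos_of_pos (hx k) _).ne', ← Finset.prod_mul_distrib]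
  simp only [Real.rpow_add_one (hx _).ne']

theorem det_scalarSecondForm_alphaImmersion (α : ℝ) (hx : ∀ k, 0 < chartInv x k) :
    (scalarSecondForm (alphaImmersion α) (alphaNormal α (chartInv x)) x).det =
      (-(α + 1) / 2) ^ n / ∏ k, chartInv x k := by
  have hsum : ∑ k, chartInv x k = 1 := by
    simp [chartInv, Fin.sum_univ_castSucc]
  rw [scalarSecondForm_alphaImmersion α hx, det_smul, Fintype.card_fin,
    det_simplexGram_inv fun k => (hx k).ne', hsum, mul_one_div]

theorem Scal_eq_prod_rpow_div (α : ℝ) {ϑ : Fin 3 → ℝ} (hϑ : ϑ ∈ P 3) :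
    Scal α ϑ = (α + 1) ^ 2 / 2 * ((∏ k, ϑ k ^ α) / (∑ k, ϑ k ^ (α + 1)) ^ 2) := by
  have hpos : ∀ k, 0 < chartInv (chart ϑ) k := (chartInv_chart hϑ).symm ▸ hϑ.1
  have hmetric := det_pullbackMetric_alphaImmersion α hpos
  have hform := det_scalarSecondForm_alphaImmersion α hpos
  have hnormal := pdVec_alphaImmersion_dotProduct_alphaNormal α hpos
  simp only [chartInv_chart hϑ] at hmetric hform hnormal
  have hnormal_sq := alphaNormal_dotProduct_self α hϑ.1
  have hsum : 0 < ∑ k, ϑ k ^ (α + 1) :=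
    Finset.sum_pos (fun k _ => Real.rpow_pos_of_pos (hϑ.1 k) _) Finset.univ_nonempty
  have hprod : 0 < ∏ k, ϑ k := Finset.prod_pos fun k _ => hϑ.1 k
  have hprod_rpow : 0 < ∏ k, ϑ k ^ α :=
    Finset.prod_pos fun k _ => Real.rpow_pos_of_pos (hϑ.1 k) _
  have hnormal_ne : alphaNormal α ϑ ≠ 0 := fun h =>
    hsum.ne' (by rw [← hnormal_sq, h, dotProduct_zero])
  rw [Scal, alphaMetric_eq_pullbackMetric,
    scalarCurvature_surface (contDiffAt_alphaImmersion α hpos)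
      (hmetric.trans_ne (by positivity)) hnormal hnormal_ne, hform, hmetric, hnormal_sq]
  field_simp

end AlphaMetric

section Majorization

variable {n : ℕ}

/-- The vector obtained from `a` by moving the mass `x` from the entry `i` to the entry `j`, known
as a Robin Hood transfer when `i` is the richer entry and remains so. -/
noncomputable def transfer (a : Fin n → ℝ) (i j : Fin n) (x : ℝ) : Fin n → ℝ :=
  a + x • (Pi.single j 1 - Pi.single i 1)

theorem transfer_zero (a : Fin n → ℝ) (i j : Fin n) : transfer a i j 0 = a := by
  simp [transfer]

theorem transfer_apply_left {a : Fin n → ℝ} {i j : Fin n} {x : ℝ} (hij : i ≠ j) :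
    transfer a i j x i = a i - x := by
  simp [transfer, hij, sub_eq_add_neg]

theorem transfer_apply_right {a : Fin n → ℝ} {i j : Fin n} {x : ℝ} (hij : i ≠ j) :
    transfer a i j x j = a j + x := by
  simp [transfer, hij.symm]

theorem transfer_apply_of_ne {a : Fin n → ℝ} {i j k : Fin n} {x : ℝ} (hki : k ≠ i) (hkj : k ≠ j) :
    transfer a i j x k = a k := by
  simp [transfer, hki, hkj]

theorem transfer_comp_perm (a : Fin n → ℝ) (σ : Equiv.Perm (Fin n)) (i j : Fin n) (x : ℝ) :
    transfer a (σ i) (σ j) x ∘ σ = transfer (a ∘ σ) i j x := by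
  funext k
  simp [transfer, Pi.single_apply]

theorem transfer_mem_P {a : Fin n → ℝ} (ha : a ∈ P n) {i j : Fin n} {x : ℝ} (hx : 0 ≤ x)
    (hxi : x < a i) : transfer a i j x ∈ P n := by
  refine ⟨fun k => ?_, ?_⟩
  · have hk := ha.1 k
    simp only [transfer, Pi.add_apply, Pi.smul_apply, Pi.sub_apply, Pi.single_apply, smul_eq_mul]
    split_ifs with hkj hki <;> subst_vars <;> linarith
  · simp [transfer, Finset.sum_add_distrib, ← Finset.mul_sum, ha.2]

theorem comp_perm_mem_P {a : Fin n → ℝ} (ha : a ∈ P n) (σ : Equiv.Perm (Fin n)) : a ∘ σ ∈ P n :=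
  ⟨fun k => ha.1 (σ k), (Equiv.sum_comp σ a).trans ha.2⟩

theorem decr_eq_comp_perm (a : Fin n → ℝ) : decr a = a ∘ Fin.revPerm.trans (Tuple.sort a) :=
  rfl

/-- Two transfers lead from `b` to `a`. If `b 1 ≤ a 1`, the first one brings the middle entry of `b`
to its value in `a`; otherwise it does so with the largest entry. -/
theorem le_of_antitone_of_sum_le {β : Type*} [Preorder β] {F : (Fin 3 → ℝ) → β}
    (hF : ∀ a ∈ P 3, ∀ i j, i ≠ j → ∀ x, 0 ≤ x → a j + x ≤ a i - x → F (transfer a i j x) ≤ F a)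
    {a b : Fin 3 → ℝ} (ha : a ∈ P 3) (hb : b ∈ P 3) (ha_anti : Antitone a)
    (h₀ : a 0 ≤ b 0) (h₁ : a 0 + a 1 ≤ b 0 + b 1) : F a ≤ F b := by
  have hsum : a 0 + a 1 + a 2 = b 0 + b 1 + b 2 := by
    rw [← Fin.sum_univ_three, ← Fin.sum_univ_three, ha.2, hb.2]
  have ha₁₀ : a 1 ≤ a 0 := ha_anti (by decide)
  have ha₂₁ : a 2 ≤ a 1 := ha_anti (by decide)
  have ha₂ : 0 < a 2 := ha.1 2
  rcases le_total (b 1) (a 1) with h | h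
  · set c := transfer b 0 1 (a 1 - b 1)
    have hc₀ : c 0 = b 0 - (a 1 - b 1) := transfer_apply_left (by decide)
    have hc₁ : c 1 = b 1 + (a 1 - b 1) := transfer_apply_right (by decide)
    have hc₂ : c 2 = b 2 := transfer_apply_of_ne (by decide) (by decide)
    have hac : a = transfer c 0 2 (a 2 - b 2) := funext fun
      | 0 => by rw [transfer_apply_left (by decide)]; linarith
      | 1 => by rw [transfer_apply_of_ne (by decide) (by decide)]; linarith
      | 2 => by rw [transfer_apply_right (by decide)]; linarith
    calc F a = F (transfer c 0 2 (a 2 - b 2)) := congrArg F hac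
      _ ≤ F c := hF c (transfer_mem_P hb (by linarith) (by linarith)) 0 2 (by decide) _
        (by linarith) (by linarith)
      _ ≤ F b := hF b hb 0 1 (by decide) _ (by linarith) (by linarith)
  · set c := transfer b 0 2 (b 0 - a 0)
    have hc₀ : c 0 = b 0 - (b 0 - a 0) := transfer_apply_left (by decide)
    have hc₁ : c 1 = b 1 := transfer_apply_of_ne (by decide) (by decide)
    have hc₂ : c 2 = b 2 + (b 0 - a 0) := transfer_apply_right (by decide)
    have hac : a = transfer c 1 2 (b 1 - a 1) := funext fun
      | 0 => by rw [transfer_apply_of_ne (by decide) (by decide)]; linarith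
      | 1 => by rw [transfer_apply_left (by decide)]; linarith
      | 2 => by rw [transfer_apply_right (by decide)]; linarith
    calc F a = F (transfer c 1 2 (b 1 - a 1)) := congrArg F hac
      _ ≤ F c := hF c (transfer_mem_P hb (by linarith) (by linarith)) 1 2 (by decide) _
        (by linarith) (by linarith)
      _ ≤ F b := hF b hb 0 2 (by decide) _ (by linarith) (by linarith)

theorem exists_perm_zero_one {i j : Fin 3} (hij : i ≠ j) :
    ∃ σ : Equiv.Perm (Fin 3), σ 0 = i ∧ σ 1 = j := by
  revert i j
  decide

theorem le_of_majorized {β : Type*} [Preorder β] {F : (Fin 3 → ℝ) → β}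
    (hperm : ∀ a ∈ P 3, ∀ σ : Equiv.Perm (Fin 3), F (a ∘ σ) = F a)
    (htransfer : ∀ a ∈ P 3, ∀ x, 0 ≤ x → a 1 + x ≤ a 0 - x → F (transfer a 0 1 x) ≤ F a)
    {a b : Fin 3 → ℝ} (ha : a ∈ P 3) (hb : b ∈ P 3) (hab : Majorized a b) : F a ≤ F b := by
  have hF : ∀ a ∈ P 3, ∀ i j, i ≠ j → ∀ x, 0 ≤ x → a j + x ≤ a i - x →
      F (transfer a i j x) ≤ F a := by
    intro a ha i j hij x hx hax
    obtain ⟨σ, rfl, rfl⟩ := exists_perm_zero_one hij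
    have haσ := comp_perm_mem_P ha σ
    rw [← hperm a ha σ, ← hperm _ (transfer_mem_P ha hx (by linarith [ha.1 (σ 1)])) σ,
      transfer_comp_perm]
    exact htransfer _ haσ x hx hax
  have hdecr {a : Fin 3 → ℝ} (ha : a ∈ P 3) : decr a ∈ P 3 ∧ F (decr a) = F a := by
    rw [decr_eq_comp_perm]
    exact ⟨comp_perm_mem_P ha _, hperm a ha _⟩
  rw [← (hdecr ha).2, ← (hdecr hb).2]
  refine le_of_antitone_of_sum_le hF (hdecr ha).1 (hdecr hb).1 (decr_antitone a) ?_ ?_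
  · simpa [Finset.sum_filter, Fin.sum_univ_three] using hab 1 le_rfl (by norm_num)
  · simpa [Finset.sum_filter, Fin.sum_univ_three] using hab 2 one_le_two (by norm_num)

end Majorization

section Conjecture

/-- The function of the transferred mass `x` that determines the scalar curvature along a transfer
from the entry `0` to the entry `1` of `a`. -/
noncomputable def transferRatio (α : ℝ) (a : Fin 3 → ℝ) (x : ℝ) : ℝ :=
  (a 0 - x) ^ α * (a 1 + x) ^ α /
    ((a 0 - x) ^ (α + 1) + (a 1 + x) ^ (α + 1) + a 2 ^ (α + 1)) ^ 2

theorem Scal_comp_perm (α : ℝ) {a : Fin 3 → ℝ} (ha : a ∈ P 3) (σ : Equiv.Perm (Fin 3)) :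
    Scal α (a ∘ σ) = Scal α a := by
  rw [Scal_eq_prod_rpow_div α ha, Scal_eq_prod_rpow_div α (comp_perm_mem_P ha σ)]
  simp only [Function.comp_apply, Equiv.prod_comp σ fun k => a k ^ α,
    Equiv.sum_comp σ fun k => a k ^ (α + 1)]

theorem Scal_transfer (α : ℝ) {a : Fin 3 → ℝ} {x : ℝ} (ha : transfer a 0 1 x ∈ P 3) :
    Scal α (transfer a 0 1 x) = (α + 1) ^ 2 / 2 * a 2 ^ α * transferRatio α a x := by
  rw [Scal_eq_prod_rpow_div α ha, transferRatio, Fin.prod_univ_three, Fin.sum_univ_three,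
    transfer_apply_left (by decide), transfer_apply_right (by decide),
    transfer_apply_of_ne (by decide) (by decide)]
  ring

theorem Scal_eq_transferRatio_zero (α : ℝ) {a : Fin 3 → ℝ} (ha : a ∈ P 3) :
    Scal α a = (α + 1) ^ 2 / 2 * a 2 ^ α * transferRatio α a 0 := by
  have h := Scal_transfer (x := 0) α (by rwa [transfer_zero])
  rwa [transfer_zero] at h

theorem Scal_transfer_le {α : ℝ} {a : Fin 3 → ℝ} (ha : a ∈ P 3) {x : ℝ} (hx : 0 ≤ x)
    (hxa : x < a 0) (h : transferRatio α a x ≤ transferRatio α a 0) :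
    Scal α (transfer a 0 1 x) ≤ Scal α a := by
  have ha₂ := ha.1 2
  rw [Scal_transfer α (transfer_mem_P ha hx hxa), Scal_eq_transferRatio_zero α ha]
  gcongr

theorem le_Scal_transfer {α : ℝ} {a : Fin 3 → ℝ} (ha : a ∈ P 3) {x : ℝ} (hx : 0 ≤ x)
    (hxa : x < a 0) (h : transferRatio α a 0 ≤ transferRatio α a x) :
    Scal α a ≤ Scal α (transfer a 0 1 x) := by
  have ha₂ := ha.1 2
  rw [Scal_transfer α (transfer_mem_P ha hx hxa), Scal_eq_transferRatio_zero α ha]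
  gcongr

end Conjecture

end AlphaGeometry

open AlphaGeometry in
theorem mainTheorem6_general (α : ℝ) :
    ((∀ a ∈ P 3, a 0 > a 1 →
        AntitoneOn (transferRatio α a) (Set.Icc 0 ((a 0 - a 1) / 2))) → ScalIncreasing 2 α) ∧
    ((∀ a ∈ P 3, a 0 > a 1 →
        MonotoneOn (transferRatio α a) (Set.Icc 0 ((a 0 - a 1) / 2))) → ScalDecreasing 2 α) := by
  constructor <;> intro h a ha b hb hab
  · refine le_of_majorized (fun _ => Scal_comp_perm α) (fun a ha x hx hax => ?_) ha hb hab
    rcases hx.eq_or_lt with rfl | hx₀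
    · rw [transfer_zero]
    · refine Scal_transfer_le ha hx (by linarith [ha.1 1]) ?_
      exact h a ha (by linarith) ⟨le_rfl, by linarith⟩ ⟨hx, by linarith⟩ hx
  · refine le_of_majorized (F := fun a => OrderDual.toDual (Scal α a))
      (fun _ => Scal_comp_perm α) (fun a ha x hx hax => ?_) ha hb hab
    rcases hx.eq_or_lt with rfl | hx₀
    · rw [transfer_zero]
    · refine OrderDual.toDual_le_toDual.2 (le_Scal_transfer ha hx (by linarith [ha.1 1]) ?_)
      exact h a ha (by linarith) ⟨le_rfl, by linarith⟩ ⟨hx, by linarith⟩ hx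

theorem mainTheorem6 :
    (∀ α : ℝ, -1 < α → α < 0 →
      (∀ a : Fin 3 → ℝ, a ∈ AlphaGeometry.P 3 → a 0 > a 1 →
        AntitoneOn
          (fun x : ℝ => (a 0 - x) ^ α * (a 1 + x) ^ α /
            ((a 0 - x) ^ (α + 1) + (a 1 + x) ^ (α + 1) + a 2 ^ (α + 1)) ^ 2)
          (Set.Icc 0 ((a 0 - a 1) / 2))) →
      AlphaGeometry.ScalIncreasing 2 α) ∧
    (∀ α : ℝ, 0 < α → α < 1 →
      (∀ a : Fin 3 → ℝ, a ∈ AlphaGeometry.P 3 → a 0 > a 1 →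
        MonotoneOn
          (fun x : ℝ => (a 0 - x) ^ α * (a 1 + x) ^ α /
            ((a 0 - x) ^ (α + 1) + (a 1 + x) ^ (α + 1) + a 2 ^ (α + 1)) ^ 2)
          (Set.Icc 0 ((a 0 - a 1) / 2))) →
      AlphaGeometry.ScalDecreasing 2 α) :=
  ⟨fun α _ _ => (mainTheorem6_general α).1, fun α _ _ => (mainTheorem6_general α).2⟩
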